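/- Let $p>0$, $p+q=1$, $p\le q$. Let $X_0=0$ and let $X_1,X_2,\dots$ be independent integer random variables such that, for $i\ge 1$: if $i\equiv 1,2 \pmod 4$ (red light), then $\mathbb P\{X_i=1\}=p$ and $\mathbb P\{X_i=0\}=q$; if $i\equiv 3,4\pmod 4$ (green light), then $\mathbb P\{X_i=0\}=p$ and $\mathbb P\{X_i=-1\}=q$. Put $S_0=X_0$ and $S_j=\max\{S_{j-1}+X_j,0\}$ for $j\ge1$. (This is the traffic-light queue with blocks of length $\ell=2$.) Write $r=\sqrt{1+4pq}$. (a) For all $z\in\mathbb C$, $$(q+pz)^4-z^2=(1-z)(q^2-p^2z)\left[q^2+(1+2pq)z+p^2z^2\right].$$ The set of roots of $z^2=(q+pz)^4$ with $|z|\le 1$ is $\{1,z_1\}$, where $$z_1=\frac{-1-2pq+r}{2p^2}\neq 1,\qquad q+pz_1\ne0 .$$ (b) The linear system $$\begin{pmatrix}1&1\\ 1&\frac{z_1}{q+pz_1}\end{pmatrix}\begin{pmatrix}w_0\\ w_1\end{pmatrix}=\begin{pmatrix}\frac{2(q-p)}{q}\\ 0\end{pmatrix}$$ has the unique solution $$w_0=\frac{4(q-p)}{2+(q-p)+r},\qquad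 w_1=\frac{4p(q-p)}{q\left[-(q-p)+r\right]}.$$ (c) Define $$H(z)=\frac{4q(q-p)(q+pz)}{(q^2-p^2z)\left[q^2+(1+2pq)z+p^2z^2\right]}\left\{\frac1{2+(q-p)+r}+\frac{pz}{q(q+pz)\left[-(q-p)+r\right]}\right\}.$$ For every $z\in\mathbb C$ with $z^2\ne(q+pz)^4$ and $q+pz\neq0$, $$\frac{(q+pz)^2}{z^2-(q+pz)^4}\left(\frac z{q+pz}-1\right)\left(w_0+w_1\frac z{q+pz}\right)=H(z).$$ (d) At the ends of the light cycles, $$\lim_{n\to\infty}\mathbb P\{S_{4n}=0\}=\frac{4(q-p)}{q^2(1+2q+r)},$$ $$\lim_{n\to\infty}\mathbb P\{S_{4n}=1\}=\frac{4(q-p)\left[1+2pq(q-p)-(q-p+2pq)r\right]}{q^4\left[-(q-p)+r\right](1+2q+r)}.$$ (e) If $p<q$, then $\pi_x=\lim_{n\to\infty}\mathbb P\{S_{4n}=x\}$ exists for every $x=0,1,2,\dots$, $\sum_x\pi_x=1$, and the generating function of this limiting distribution is $H$: $\sum_{x\ge0}\pi_xz^x=H(z)$ for all $z\in\mathbb C$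 with $|z|\le1$, $z\ne z_1$ (at $z_1$ the formula for $H$ has a removable singularity). Moreover each $S_n$ is integrable, and $$\lim_{n\to\infty}\mathbb E(S_{4n})=H'(1)=\frac14\left[-4+2(q-p)+\frac1{q-p}+r\right].$$ -/

import Mathlib

open MeasureTheory ProbabilityTheory Filter Topology

/-- The steps of the traffic-light walk with light blocks of length `ℓ` and arrival probability
`p` (and `q = 1 - p`): `X 0 = 0`, the `X i` are independent, and for `i ≥ 1` the step `X i` is
`1` or `0` with probabilities `p`, `q` when the light is red
(`i ≡ 1, …, ℓ` modulo `2 ℓ`), and `0` or `-1` with probabilities `p`, `q` when it is green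
(`i ≡ ℓ + 1, …, 2 ℓ` modulo `2 ℓ`). -/
structure IsTrafficSteps {Ω : Type*} [MeasurableSpace Ω] (μ : Measure Ω) (ℓ : ℕ) (p q : ℝ)
    (X : ℕ → Ω → ℤ) : Prop where
  measurable : ∀ i, Measurable (X i)
  indep : iIndepFun X μ
  zero : ∀ ω, X 0 ω = 0
  red : ∀ i, 1 ≤ i → (∃ r, 1 ≤ r ∧ r ≤ ℓ ∧ i ≡ r [MOD 2 * ℓ]) →
    μ.real {ω | X i ω = 1} = p ∧ μ.real {ω | X i ω = 0} = q
  green : ∀ i, 1 ≤ i → (∃ r, ℓ + 1 ≤ r ∧ r ≤ 2 * ℓ ∧ i ≡ r [MOD 2 * ℓ]) →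
    μ.real {ω | X i ω = 0} = p ∧ μ.real {ω | X i ω = -1} = q

/-- The reflected walk `S 0 = X 0`, `S j = max (S (j - 1) + X j) 0`. -/
def queueLength {Ω : Type*} (X : ℕ → Ω → ℤ) : ℕ → Ω → ℤ
  | 0, ω => X 0 ω
  | j + 1, ω => max (queueLength X j ω + X (j + 1) ω) 0

/-- The coefficient matrix of the linear system for the weights `w`: its `(i, j)` entry is
`(z i / (q + p * z i)) ^ j`. -/
noncomputable def weightMatrix {ℓ : ℕ} (p q : ℝ) (z : Fin ℓ → ℂ) : Matrix (Fin ℓ) (Fin ℓ) ℂ :=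
  Matrix.of fun i j => (z i / (q + p * z i)) ^ (j : ℕ)

/-- The right-hand side `(ℓ (q - p) / q, 0, …, 0)` of the linear system for the weights. -/
noncomputable def weightRHS (ℓ : ℕ) (p q : ℝ) : Fin ℓ → ℂ :=
  fun i => if (i : ℕ) = 0 then ((q - p) / q * ℓ : ℂ) else 0

/-- The generating function built from weights `w` for blocks of length `ℓ`. -/
noncomputable def weightPGF {ℓ : ℕ} (p q : ℝ) (w : Fin ℓ → ℂ) (z : ℂ) : ℂ :=
  (q + p * z) ^ ℓ / (z ^ ℓ - (q + p * z) ^ (2 * ℓ)) * (z / (q + p * z) - 1) *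
    ∑ k : Fin ℓ, w k * (z / (q + p * z)) ^ (k : ℕ)

/-- The root `z₁` of `z² = (q + p z)⁴` inside the unit disc. -/
noncomputable def innerRoot (p q : ℝ) : ℝ :=
  (-1 - 2 * p * q + √(1 + 4 * p * q)) / (2 * p ^ 2)

/-- The explicit weight `w₀` for `ℓ = 2`. -/
noncomputable def weightZero (p q : ℝ) : ℝ :=
  4 * (q - p) / (2 + (q - p) + √(1 + 4 * p * q))

/-- The explicit weight `w₁` for `ℓ = 2`. -/
noncomputable def weightOne (p q : ℝ) : ℝ :=
  4 * p * (q - p) / (q * (-(q - p) + √(1 + 4 * p * q)))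

/-- The explicit generating function `H` for `ℓ = 2`. -/
noncomputable def explicitPGF (p q : ℝ) (z : ℂ) : ℂ :=
  4 * q * (q - p) * (q + p * z) /
      ((q ^ 2 - p ^ 2 * z) * (q ^ 2 + (1 + 2 * p * q) * z + p ^ 2 * z ^ 2)) *
    (1 / (2 + (q - p) + (√(1 + 4 * p * q) : ℝ)) +
      p * z / (q * (q + p * z) * (-(q - p) + (√(1 + 4 * p * q) : ℝ))))

/-! Describe the law of the queue by its tail `x ↦ P(S ≥ x)`. A light cycle acts on tails by the
monotone operator `cycleStep`, and the empty queue has the least tail. Its iterates therefore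
increase to a fixed tail `L` (`exists_limit_tail`), so the limits exist without any Markov chain
theory. The geometric tail of ratio `p² / q²` is a supersolution and dominates every iterate
(`iterate_le_geometric`). For `p < q` this prevents loss of mass at infinity and justifies passing
to the limit in the mean.

The fixed point equation becomes a functional equation for the generating function of `L`
(`IsTail.tailPGF_fixed`), with two unknown constants: the limiting probabilities of an empty queue
just before each of the two green steps. After division by `z - 1` (`tailPGF_mul_eq`), evaluation at
`1` and at the inner root, where the left side vanishes, gives exactly the linear system for the
weights (`boundary_weights`). The generating function, the first two probabilities and, through the
slope at `1`, the mean follow. -/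

theorem pow_four_sub_sq_factorization {p q : ℝ} (hpq : p + q = 1) (z : ℂ) :
    (q + p * z) ^ 4 - z ^ 2 =
      (1 - z) * (q ^ 2 - p ^ 2 * z) * (q ^ 2 + (1 + 2 * p * q) * z + p ^ 2 * z ^ 2) := by
  have h : (q : ℂ) = 1 - p := by
    rw [← Complex.ofReal_one, ← hpq]; push_cast; ring
  rw [h]; ring

/-! ### Algebra of the roots, the weights and the explicit generating function -/

section Discriminant

variable {p q : ℝ} (hp : 0 < p) (hpq : p + q = 1) (hle : p ≤ q)
include hp hpq hle

omit hpq in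
theorem sq_sqrt_disc : √(1 + 4 * p * q) ^ 2 = 1 + 4 * p * q :=
  Real.sq_sqrt (by nlinarith [mul_nonneg hp.le (hp.le.trans hle)])

omit hpq in
theorem one_lt_sqrt_disc : 1 < √(1 + 4 * p * q) := by
  apply Real.lt_sqrt_of_sq_lt
  nlinarith [mul_pos hp (hp.trans_le hle)]

omit hpq in
theorem sqrt_disc_lt : √(1 + 4 * p * q) < 1 + 2 * p * q := by
  rw [Real.sqrt_lt' (by nlinarith [mul_pos hp (hp.trans_le hle)])]
  nlinarith [mul_pos hp (hp.trans_le hle)]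

omit hpq in
theorem quadratic_factor (z : ℂ) :
    q ^ 2 + (1 + 2 * p * q) * z + p ^ 2 * z ^ 2 =
      p ^ 2 * (z - innerRoot p q) *
        (z - ((-1 - 2 * p * q - √(1 + 4 * p * q)) / (2 * p ^ 2) : ℝ)) := by
  have hr : ((√(1 + 4 * p * q) : ℝ) : ℂ) ^ 2 = 1 + 4 * p * q := by
    exact_mod_cast sq_sqrt_disc hp hle
  have hp' : (p : ℂ) ≠ 0 := by exact_mod_cast hp.ne'
  unfold innerRoot
  push_cast
  field_simp
  linear_combination hr

omit hpq in
theorem innerRoot_neg : innerRoot p q < 0 :=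
  div_neg_of_neg_of_pos (by linarith [sqrt_disc_lt hp hle]) (by positivity)

theorem neg_one_lt_innerRoot : -1 < innerRoot p q := by
  unfold innerRoot
  rw [lt_div_iff₀ (by positivity)]
  have := one_lt_sqrt_disc hp hle
  have hq : q = 1 - p := by linarith
  -- After squaring, this is `(q - p)² < 1`.
  have : 1 + 2 * p * q - 2 * p ^ 2 < √(1 + 4 * p * q) := by
    apply Real.lt_sqrt_of_sq_lt
    subst hq
    nlinarith [pow_pos hp 2, pow_pos hp 3, mul_nonneg (pow_pos hp 2).le (sub_nonneg.2 hle)]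
  linarith

theorem add_mul_innerRoot_pos : 0 < q + p * innerRoot p q := by
  nlinarith [neg_one_lt_innerRoot hp hpq hle]

/-- The other two roots are `q² / p² ≥ 1`, which meets the disc only when `p = q` and then equals
`1`, and the second root of the quadratic, which is below `-1`. -/
theorem setOf_roots_closedBall :
    {z : ℂ | z ^ 2 = (q + p * z) ^ 4 ∧ ‖z‖ ≤ 1} = {1, (innerRoot p q : ℂ)} := by
  have hp' : (p : ℂ) ≠ 0 := by exact_mod_cast hp.ne'
  ext z
  simp only [Set.mem_ofPred_eq, Set.mem_insert_iff, Set.mem_singleton_iff]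
  have key : z ^ 2 = (q + p * z) ^ 4 ↔ (1 - z) * (q ^ 2 - p ^ 2 * z) *
      (q ^ 2 + (1 + 2 * p * q) * z + p ^ 2 * z ^ 2) = 0 := by
    rw [← pow_four_sub_sq_factorization hpq, sub_eq_zero, eq_comm]
  rw [key, quadratic_factor hp hle]
  constructor
  · rintro ⟨h, hz⟩
    rcases mul_eq_zero.1 h with h | h
    · rcases mul_eq_zero.1 h with h | h
      · left; linear_combination -h
      · left
        have hzq : z = ((q ^ 2 / p ^ 2 : ℝ) : ℂ) := by
          push_cast
          field_simp
          linear_combination -h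
        rw [hzq, Complex.norm_real, Real.norm_of_nonneg (by positivity),
          div_le_one (by positivity)] at hz
        have : q = p := le_antisymm ((sq_le_sq₀ (hp.le.trans hle) hp.le).1 hz) hle
        rw [hzq, this, div_self (by positivity), Complex.ofReal_one]
    · rcases mul_eq_zero.1 h with h | h
      · right
        rcases mul_eq_zero.1 h with h | h
        · exact absurd h (pow_ne_zero 2 hp')
        · linear_combination h
      · exfalso
        rw [sub_eq_zero] at h
        rw [h, Complex.norm_real, Real.norm_eq_abs] at hz
        have := (abs_le.1 hz).1
        rw [le_div_iff₀ (by positivity)] at this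
        nlinarith [one_lt_sqrt_disc hp hle, mul_pos hp (hp.trans_le hle)]
  · rintro (rfl | rfl)
    · simp
    · refine ⟨by simp, ?_⟩
      rw [Complex.norm_real, Real.norm_eq_abs, abs_le]
      exact ⟨(neg_one_lt_innerRoot hp hpq hle).le, by linarith [innerRoot_neg hp hle]⟩

theorem weightZero_add_weightOne : weightZero p q + weightOne p q = 2 * (q - p) / q := by
  have hr := sq_sqrt_disc hp hle
  have hr1 := one_lt_sqrt_disc hp hle
  have hq : 0 < q := hp.trans_le hle
  unfold weightZero weightOne
  generalize √(1 + 4 * p * q) = r at *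
  have h1 : 2 + (q - p) + r ≠ 0 := by linarith
  have h2 : -(q - p) + r ≠ 0 := by linarith
  have h3 : p = 1 - q := by linarith
  subst h3
  field_simp
  grind

theorem innerRoot_weight_eq :
    (q + p * innerRoot p q) * weightZero p q + innerRoot p q * weightOne p q = 0 := by
  have hr := sq_sqrt_disc hp hle
  have hr1 := one_lt_sqrt_disc hp hle
  have hq : 0 < q := hp.trans_le hle
  unfold weightZero weightOne innerRoot
  generalize √(1 + 4 * p * q) = r at *
  have h1 : 2 + (q - p) + r ≠ 0 := by linarith
  have h2 : -(q - p) + r ≠ 0 := by linarith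
  have h3 : q = 1 - p := by linarith
  subst h3
  field_simp
  grind

/-- Up to sign the determinant is `q + p z₁ - z₁ = q (1 - z₁)`, which is positive because `z₁ < 0`.
The second equation is cleared of its denominator, the form in which the functional equation
delivers it. -/
theorem weights_unique {a b : ℂ} (h1 : a + b = 2 * (q - p) / q)
    (h2 : (q + p * innerRoot p q) * a + innerRoot p q * b = 0) :
    a = weightZero p q ∧ b = weightOne p q := by
  have e1 : (weightZero p q + weightOne p q : ℂ) = 2 * (q - p) / q := by
    exact_mod_cast weightZero_add_weightOne hp hpq hle
  have e2 : (q + p * innerRoot p q) * weightZero p q + innerRoot p q * weightOne p q = (0 : ℂ) := by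
    exact_mod_cast innerRoot_weight_eq hp hpq hle
  have hne : (q + p * innerRoot p q - innerRoot p q : ℂ) ≠ 0 := by
    have : 0 < q + p * innerRoot p q - innerRoot p q := by
      nlinarith [innerRoot_neg hp hle, hp.trans_le hle]
    exact_mod_cast this.ne'
  have ha : a = weightZero p q := by
    apply mul_left_cancel₀ hne
    linear_combination h2 - e2 - innerRoot p q * (h1 - e1)
  exact ⟨ha, by linear_combination h1 - e1 - ha⟩

theorem weight_system_iff (w : Fin 2 → ℂ) :
    (weightMatrix p q ![1, (innerRoot p q : ℂ)]).mulVec w = weightRHS 2 p q ↔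
      w = ![(weightZero p q : ℂ), (weightOne p q : ℂ)] := by
  have hone : (q + p : ℂ) = 1 := by rw [add_comm]; exact_mod_cast hpq
  have hz : (q + p * innerRoot p q : ℂ) ≠ 0 := by
    exact_mod_cast (add_mul_innerRoot_pos hp hpq hle).ne'
  have key : (weightMatrix p q ![1, (innerRoot p q : ℂ)]).mulVec w = weightRHS 2 p q ↔
      w 0 + w 1 = 2 * (q - p) / q ∧
        (q + p * innerRoot p q) * w 0 + innerRoot p q * w 1 = 0 := by
    have e : (q + p * innerRoot p q) * w 0 + innerRoot p q * w 1 = (q + p * innerRoot p q) *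
        (w 0 + innerRoot p q / (q + p * innerRoot p q) * w 1) := by
      field_simp
    rw [e, mul_eq_zero, or_iff_right hz, funext_iff, Fin.forall_fin_two]
    simp [weightMatrix, weightRHS, Matrix.mulVec, dotProduct, Fin.sum_univ_two, hone]
    intro _
    rw [div_mul_eq_mul_div, mul_comm (2 : ℂ)]
  rw [key]
  constructor
  · rintro ⟨h1, h2⟩
    obtain ⟨ha, hb⟩ := weights_unique hp hpq hle h1 h2
    ext i
    fin_cases i
    · simpa using ha
    · simpa using hb
  · rintro rfl
    constructor
    · simp only [Matrix.cons_val_zero, Matrix.cons_val_one]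
      exact_mod_cast weightZero_add_weightOne hp hpq hle
    · simp only [Matrix.cons_val_zero, Matrix.cons_val_one]
      exact_mod_cast innerRoot_weight_eq hp hpq hle

theorem explicitPGF_eq {z : ℂ} (hz : q + p * z ≠ 0) :
    explicitPGF p q z = q * ((q + p * z) * weightZero p q + z * weightOne p q) /
      ((q ^ 2 - p ^ 2 * z) * (q ^ 2 + (1 + 2 * p * q) * z + p ^ 2 * z ^ 2)) := by
  have hr1 := one_lt_sqrt_disc hp hle
  have hq : (q : ℂ) ≠ 0 := by exact_mod_cast (hp.trans_le hle).ne'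
  have h1 : (2 + (q - p) + (√(1 + 4 * p * q) : ℝ) : ℂ) ≠ 0 := by
    have : 2 + (q - p) + √(1 + 4 * p * q) ≠ 0 := by linarith
    exact_mod_cast this
  have h2 : (-(q - p) + (√(1 + 4 * p * q) : ℝ) : ℂ) ≠ 0 := by
    have : -(q - p) + √(1 + 4 * p * q) ≠ 0 := by linarith
    exact_mod_cast this
  unfold explicitPGF weightZero weightOne
  rw [div_mul_eq_mul_div]
  congr 1
  push_cast
  field_simp

theorem weightPGF_eq_explicitPGF {z : ℂ} (h : z ^ 2 ≠ (q + p * z) ^ 4) (hz : q + p * z ≠ 0) :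
    weightPGF p q ![(weightZero p q : ℂ), (weightOne p q : ℂ)] z = explicitPGF p q z := by
  have hf := pow_four_sub_sq_factorization hpq z
  rw [explicitPGF_eq hp hpq hle hz]
  have hD : z ^ 2 - (q + p * z) ^ 4 ≠ 0 := sub_ne_zero.2 h
  have hD' : (q ^ 2 - p ^ 2 * z) * (q ^ 2 + (1 + 2 * p * q) * z + p ^ 2 * z ^ 2) ≠ 0 := by
    intro h0
    apply hD
    linear_combination -hf - (1 - z) * h0
  have hq : (q : ℂ) = 1 - p := by
    rw [← Complex.ofReal_one, ← hpq]; push_cast; ring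
  simp only [weightPGF, Fin.sum_univ_two, Matrix.cons_val_zero, Matrix.cons_val_one,
    Fin.val_zero, Fin.val_one, pow_zero, pow_one, mul_one]
  rw [div_mul_eq_mul_div, div_mul_eq_mul_div, div_eq_div_iff hD hD']
  -- Since `z - (q + p z) = q (z - 1)`, the factor `z - 1` cancels against the one in the
  -- factorization.
  have e : (q + p * z : ℂ) ^ 2 * (z / (q + p * z) - 1) *
      (weightZero p q + weightOne p q * (z / (q + p * z))) =
      q * (z - 1) * ((q + p * z) * weightZero p q + z * weightOne p q) := by
    field_simp
    rw [hq]; ring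
  rw [e]
  linear_combination q * ((q + p * z) * weightZero p q + z * weightOne p q) * hf

theorem weightZero_div_eq : weightZero p q / q ^ 2 =
    4 * (q - p) / (q ^ 2 * (1 + 2 * q + √(1 + 4 * p * q))) := by
  have hr1 := one_lt_sqrt_disc hp hle
  have hq : 0 < q := hp.trans_le hle
  unfold weightZero
  have h : 2 + (q - p) + √(1 + 4 * p * q) = 1 + 2 * q + √(1 + 4 * p * q) := by linarith
  rw [h, div_div, mul_comm (q ^ 2)]

theorem second_limit_eq : (weightOne p q - (1 + 2 * p) * weightZero p q) / q ^ 3 =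
    4 * (q - p) * (1 + 2 * p * q * (q - p) - (q - p + 2 * p * q) * √(1 + 4 * p * q)) /
        (q ^ 4 * (-(q - p) + √(1 + 4 * p * q)) * (1 + 2 * q + √(1 + 4 * p * q))) := by
  have hr := sq_sqrt_disc hp hle
  have hr1 := one_lt_sqrt_disc hp hle
  have hq : 0 < q := hp.trans_le hle
  unfold weightZero weightOne
  have h : 2 + (q - p) + √(1 + 4 * p * q) = 1 + 2 * q + √(1 + 4 * p * q) := by linarith
  rw [h]
  generalize √(1 + 4 * p * q) = r at *
  have h1 : 1 + 2 * q + r ≠ 0 := by linarith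
  have h2 : -(q - p) + r ≠ 0 := by linarith
  have h3 : p = 1 - q := by linarith
  subst h3
  field_simp
  grind

/-- The left side is `(N'(1) - D'(1)) / D(1)` for the quotient `N / D` of `explicitPGF_eq`, where
`N(1) = D(1) = 2 (q - p)`. -/
theorem weight_mean_eq (hlt : p < q) :
    (q * (p * weightZero p q + weightOne p q) -
        (-2 * p ^ 2 + (q - p) * (1 + 2 * p))) / (2 * (q - p)) =
      (-4 + 2 * (q - p) + 1 / (q - p) + √(1 + 4 * p * q)) / 4 := by
  have hr := sq_sqrt_disc hp hle
  have hr1 := one_lt_sqrt_disc hp hle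
  have hq : 0 < q := hp.trans_le hle
  unfold weightZero weightOne
  generalize √(1 + 4 * p * q) = r at *
  have h1 : 2 + (q - p) + r ≠ 0 := by linarith
  have h2 : -(q - p) + r ≠ 0 := by linarith
  have h4 : q - p ≠ 0 := by linarith
  have h3 : p = 1 - q := by linarith
  subst h3
  field_simp
  grind

theorem hasDerivAt_explicitPGF_one (hlt : p < q) :
    HasDerivAt (explicitPGF p q)
      (((-4 + 2 * (q - p) + 1 / (q - p) + √(1 + 4 * p * q)) / 4 : ℝ) : ℂ) 1 := by
  have hone : (q + p : ℂ) = 1 := by rw [add_comm]; exact_mod_cast hpq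
  have hq : (q : ℂ) = 1 - p := by linear_combination hone
  have hq0 : (q : ℂ) ≠ 0 := by exact_mod_cast (hp.trans_le hle).ne'
  have hd : (q - p : ℂ) ≠ 0 := by exact_mod_cast (sub_pos.2 hlt).ne'
  have hsum : (weightZero p q + weightOne p q : ℂ) = 2 * (q - p) / q := by
    exact_mod_cast weightZero_add_weightOne hp hpq hle
  have hN : HasDerivAt (fun z : ℂ => q * ((q + p * z) * weightZero p q + z * weightOne p q))
      (q * (p * weightZero p q + weightOne p q)) 1 := by
    have h1 : HasDerivAt (fun z : ℂ => (q + p * z : ℂ)) (p * 1) 1 :=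
      ((hasDerivAt_id _).const_mul _).const_add _
    have := ((h1.mul_const (weightZero p q : ℂ)).add
      ((hasDerivAt_id (1 : ℂ)).mul_const (weightOne p q : ℂ))).const_mul (q : ℂ)
    exact this.congr_deriv (by ring)
  have hD : HasDerivAt (fun z : ℂ => (q ^ 2 - p ^ 2 * z) *
      (q ^ 2 + (1 + 2 * p * q) * z + p ^ 2 * z ^ 2) : ℂ → ℂ)
      (-2 * p ^ 2 + (q - p) * (1 + 2 * p)) 1 := by
    have h1 : HasDerivAt (fun z : ℂ => (q ^ 2 - p ^ 2 * z : ℂ)) (-(p ^ 2 * 1)) 1 :=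
      ((hasDerivAt_id _).const_mul _).const_sub _
    have h2 : HasDerivAt (fun z : ℂ => (q ^ 2 + (1 + 2 * p * q) * z + p ^ 2 * z ^ 2 : ℂ))
        ((1 + 2 * p * q) * 1 + p ^ 2 * (2 * 1)) 1 := by
      have := (((hasDerivAt_id (1 : ℂ)).const_mul (1 + 2 * p * q : ℂ)).const_add (q ^ 2 : ℂ)).add
        ((hasDerivAt_pow 2 (1 : ℂ)).const_mul (p ^ 2 : ℂ))
      exact this.congr_deriv (by norm_num)
    exact (h1.mul h2).congr_deriv (by rw [hq]; ring)
  have hD1 : ((q ^ 2 - p ^ 2 * 1) * (q ^ 2 + (1 + 2 * p * q) * 1 + p ^ 2 * 1 ^ 2) : ℂ)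
      = 2 * (q - p) := by rw [hq]; ring
  have hN1 : (q * ((q + p * 1) * weightZero p q + 1 * weightOne p q) : ℂ) = 2 * (q - p) := by
    rw [mul_one, hone, one_mul, one_mul, hsum]
    field_simp
  have h := hN.div hD (by rw [hD1]; simpa using hd)
  rw [hD1, hN1] at h
  have hm : (((-4 + 2 * (q - p) + 1 / (q - p) + √(1 + 4 * p * q)) / 4 : ℝ) : ℂ) =
      (q * (p * weightZero p q + weightOne p q) -
        (-2 * p ^ 2 + (q - p) * (1 + 2 * p))) / (2 * (q - p)) := by
    rw [← weight_mean_eq hp hpq hle hlt]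
    push_cast
    rfl
  rw [hm]
  have hev : explicitPGF p q =ᶠ[𝓝 1] fun z =>
      q * ((q + p * z) * weightZero p q + z * weightOne p q) /
      ((q ^ 2 - p ^ 2 * z) * (q ^ 2 + (1 + 2 * p * q) * z + p ^ 2 * z ^ 2)) := by
    have hc : ContinuousAt (fun z : ℂ => (q + p * z : ℂ)) 1 := by fun_prop
    filter_upwards [hc.eventually_ne (by simp [hone] : (q + p * 1 : ℂ) ≠ 0)] with z hz
    exact explicitPGF_eq hp hpq hle hz
  refine HasDerivAt.congr_of_eventuallyEq ?_ hev
  refine h.congr_deriv ?_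
  have h2d : (2 * (q - p) : ℂ) ≠ 0 := mul_ne_zero two_ne_zero hd
  rw [div_eq_div_iff (pow_ne_zero 2 h2d) h2d]
  ring

end Discriminant

/-! ### Tail functions and their generating functions -/

/-- A function of the form `x ↦ ν [x, ∞)` for a measure `ν` on `ℕ ∪ {∞}` of mass one. -/
structure IsTail (T : ℕ → ℝ) : Prop where
  zero : T 0 = 1
  anti : Antitone T
  nonneg : ∀ x, 0 ≤ T x

/-- The effect of a red step on the tail function of the queue length. -/
def redStep (p q : ℝ) (T : ℕ → ℝ) : ℕ → ℝ
  | 0 => 1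
  | x + 1 => q * T (x + 1) + p * T x

/-- The effect of a green step on the tail function of the queue length. -/
def greenStep (p q : ℝ) (T : ℕ → ℝ) : ℕ → ℝ
  | 0 => 1
  | x + 1 => p * T (x + 1) + q * T (x + 2)

/-- The effect of a full light cycle on the tail function of the queue length. -/
def cycleStep (p q : ℝ) (T : ℕ → ℝ) : ℕ → ℝ :=
  greenStep p q (greenStep p q (redStep p q (redStep p q T)))

/-- The tail function of the point mass at zero. -/
def zeroTail : ℕ → ℝ
  | 0 => 1
  | _ + 1 => 0

/-- The generating function of the law with tail function `T`. -/
noncomputable def tailPGF (T : ℕ → ℝ) (z : ℂ) : ℂ :=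
  ∑' x, ((T x - T (x + 1) : ℝ) : ℂ) * z ^ x

theorem isTail_zeroTail : IsTail zeroTail where
  zero := rfl
  anti := antitone_nat_of_succ_le fun n => by cases n <;> simp [zeroTail]
  nonneg x := by cases x <;> simp [zeroTail]

theorem zeroTail_le {T : ℕ → ℝ} (h0 : 1 ≤ T 0) (h : ∀ x, 0 ≤ T x) : zeroTail ≤ T
  | 0 => h0
  | x + 1 => h (x + 1)

namespace IsTail

variable {T : ℕ → ℝ} (hT : IsTail T)
include hT

theorem le_one (x : ℕ) : T x ≤ 1 := hT.zero ▸ hT.anti x.zero_le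

theorem redStep {p q : ℝ} (hp : 0 ≤ p) (hq : 0 ≤ q) (hpq : p + q = 1) :
    IsTail (redStep p q T) where
  zero := rfl
  anti := antitone_nat_of_succ_le fun n => by
    cases n with
    | zero =>
      simp only [_root_.redStep]
      nlinarith [hT.le_one 0, hT.le_one (0 + 1)]
    | succ n =>
      simp only [_root_.redStep]
      exact add_le_add (mul_le_mul_of_nonneg_left (hT.anti (Nat.le_succ _)) hq)
        (mul_le_mul_of_nonneg_left (hT.anti (Nat.le_succ _)) hp)
  nonneg n := by
    cases n with
    | zero => simp [_root_.redStep]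
    | succ n => exact add_nonneg (mul_nonneg hq (hT.nonneg _)) (mul_nonneg hp (hT.nonneg _))

theorem greenStep {p q : ℝ} (hp : 0 ≤ p) (hq : 0 ≤ q) (hpq : p + q = 1) :
    IsTail (greenStep p q T) where
  zero := rfl
  anti := antitone_nat_of_succ_le fun n => by
    cases n with
    | zero =>
      simp only [_root_.greenStep]
      nlinarith [hT.le_one (0 + 1), hT.le_one (0 + 2)]
    | succ n =>
      simp only [_root_.greenStep]
      exact add_le_add (mul_le_mul_of_nonneg_left (hT.anti (Nat.le_succ _)) hp)
        (mul_le_mul_of_nonneg_left (hT.anti (Nat.le_succ _)) hq)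
  nonneg n := by
    cases n with
    | zero => simp [_root_.greenStep]
    | succ n => exact add_nonneg (mul_nonneg hp (hT.nonneg _)) (mul_nonneg hq (hT.nonneg _))

theorem cycleStep {p q : ℝ} (hp : 0 ≤ p) (hq : 0 ≤ q) (hpq : p + q = 1) :
    IsTail (cycleStep p q T) :=
  (((hT.redStep hp hq hpq).redStep hp hq hpq).greenStep hp hq hpq).greenStep hp hq hpq

theorem sub_nonneg (x : ℕ) : 0 ≤ T x - T (x + 1) := _root_.sub_nonneg.2 (hT.anti x.le_succ)

theorem summable_sub : Summable fun x => T x - T (x + 1) :=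
  summable_of_sum_range_le (c := 1) hT.sub_nonneg fun n => by
    rw [Finset.sum_range_sub', hT.zero]
    linarith [hT.nonneg n]

theorem hasSum_sub (hlim : Tendsto T atTop (𝓝 0)) : HasSum (fun x => T x - T (x + 1)) 1 := by
  rw [hasSum_iff_tendsto_nat_of_nonneg hT.sub_nonneg]
  simp only [Finset.sum_range_sub', hT.zero]
  simpa using hlim.const_sub 1

theorem norm_term_le {z : ℂ} (hz : ‖z‖ ≤ 1) (x : ℕ) :
    ‖((T x - T (x + 1) : ℝ) : ℂ) * z ^ x‖ ≤ T x - T (x + 1) := by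
  rw [norm_mul, Complex.norm_real, Real.norm_of_nonneg (hT.sub_nonneg x), norm_pow]
  exact mul_le_of_le_one_right (hT.sub_nonneg x) (pow_le_one₀ (norm_nonneg _) hz)

theorem summable_term {z : ℂ} (hz : ‖z‖ ≤ 1) :
    Summable fun x => ((T x - T (x + 1) : ℝ) : ℂ) * z ^ x :=
  .of_norm_bounded hT.summable_sub (hT.norm_term_le hz)

theorem hasSum_tailPGF {z : ℂ} (hz : ‖z‖ ≤ 1) :
    HasSum (fun x => ((T x - T (x + 1) : ℝ) : ℂ) * z ^ x) (tailPGF T z) :=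
  (hT.summable_term hz).hasSum

theorem tailPGF_one (hlim : Tendsto T atTop (𝓝 0)) : tailPGF T 1 = 1 := by
  have := Complex.hasSum_ofReal.2 (hT.hasSum_sub hlim)
  simpa [tailPGF] using this.tsum_eq

theorem continuousOn_tailPGF : ContinuousOn (tailPGF T) (Metric.closedBall 0 1) :=
  continuousOn_tsum (fun _ => by fun_prop) hT.summable_sub
    fun x z hz => hT.norm_term_le (by simpa using hz) x

theorem hasSum_tailPGF_shift {z : ℂ} (hz : ‖z‖ ≤ 1) :
    HasSum (fun x => ((T (x + 1) - T (x + 2) : ℝ) : ℂ) * z ^ (x + 1))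
      (tailPGF T z - (1 - T 1 : ℝ)) := by
  have := (hasSum_nat_add_iff' 1).2 (hT.hasSum_tailPGF hz)
  simpa [hT.zero] using this

theorem tailPGF_redStep {p q : ℝ} (hpq : p + q = 1) {z : ℂ} (hz : ‖z‖ ≤ 1) :
    tailPGF (_root_.redStep p q T) z = (q + p * z) * tailPGF T z := by
  have h := ((hT.hasSum_tailPGF_shift hz).mul_left (q : ℂ)).add
    ((hT.hasSum_tailPGF hz).mul_left (p * z))
  refine HasSum.tsum_eq ((hasSum_nat_add_iff' 1).1 ?_)
  have hv : (q + p * z) * tailPGF T z - ∑ x ∈ Finset.range 1,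
      ((_root_.redStep p q T x - _root_.redStep p q T (x + 1) : ℝ) : ℂ) * z ^ x =
      q * (tailPGF T z - (1 - T 1 : ℝ)) + p * z * tailPGF T z := by
    have : (q : ℂ) = 1 - p := by rw [← Complex.ofReal_one, ← hpq]; push_cast; ring
    simp only [_root_.redStep, hT.zero, Finset.sum_range_one]
    push_cast
    rw [this]
    ring
  rw [hv]
  refine h.congr_fun fun x => ?_
  cases x
  all_goals
    simp only [_root_.redStep, hT.zero]
    push_cast
    ring

/-- Without reflection the factor would be `p + q / z`. Reflection replaces `q / z` by `q` on the
atom at zero, of mass `1 - T 1`; multiplying by `z` turns this into the correction `q (z - 1) (1 - T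
1)`. -/
theorem tailPGF_greenStep {p q : ℝ} (hp : 0 ≤ p) (hq : 0 ≤ q) (hpq : p + q = 1) {z : ℂ}
    (hz : ‖z‖ ≤ 1) :
    z * tailPGF (_root_.greenStep p q T) z =
      (q + p * z) * tailPGF T z + q * (z - 1) * (1 - T 1 : ℝ) := by
  have hG := (hT.greenStep hp hq hpq).hasSum_tailPGF hz |>.mul_left z
  have h := ((hT.hasSum_tailPGF_shift hz).mul_left (q : ℂ)).add
    ((hT.hasSum_tailPGF hz).mul_left (p * z))
  have h0 := hasSum_ite_eq (0 : ℕ) ((q : ℂ) * z * (1 - T 1 : ℝ))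
  refine hG.unique ?_
  convert h.add h0 using 1
  · ext x
    have : (q : ℂ) = 1 - p := by rw [← Complex.ofReal_one, ← hpq]; push_cast; ring
    cases x with
    | zero =>
      simp only [_root_.greenStep, hT.zero, if_true]
      push_cast
      rw [this]
      ring
    | succ x =>
      simp only [_root_.greenStep, Nat.succ_ne_zero, if_false]
      push_cast
      ring
  · ring

theorem tailPGF_fixed {p q : ℝ} (hp : 0 ≤ p) (hq : 0 ≤ q) (hpq : p + q = 1)
    (hfix : _root_.cycleStep p q T = T) {z : ℂ} (hz : ‖z‖ ≤ 1) :
    (z ^ 2 - (q + p * z) ^ 4) * tailPGF T z = (z - 1) * (q *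
      ((q + p * z) * (1 - _root_.redStep p q (_root_.redStep p q T) 1 : ℝ) + z *
        (1 - _root_.greenStep p q (_root_.redStep p q (_root_.redStep p q T)) 1 : ℝ))) := by
  have h1 := hT.redStep hp hq hpq
  have h2 := h1.redStep hp hq hpq
  have h3 := h2.greenStep hp hq hpq
  have e1 := hT.tailPGF_redStep hpq hz
  have e2 := h1.tailPGF_redStep hpq hz
  have e3 := h2.tailPGF_greenStep hp hq hpq hz
  have e4 := h3.tailPGF_greenStep hp hq hpq hz
  rw [show _root_.greenStep p q (_root_.greenStep p q (_root_.redStep p q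
    (_root_.redStep p q T))) = T from hfix] at e4
  linear_combination z * e4 + (q + p * z) * e3 + (q + p * z) ^ 2 * e2 + (q + p * z) ^ 3 * e1

/-- Summation by parts. It identifies the slope of the generating function at `1` with a series
whose value at `1` is the mean. -/
theorem one_sub_mul_tsum (hs : Summable fun x => T (x + 1)) {z : ℂ} (hz : ‖z‖ ≤ 1) :
    tailPGF T z - 1 = (z - 1) * ∑' x, (T (x + 1) : ℂ) * z ^ x := by
  have hG : Summable fun x => (T (x + 1) : ℂ) * z ^ x :=
    .of_norm_bounded hs fun x => by
      rw [norm_mul, Complex.norm_real, Real.norm_of_nonneg (hT.nonneg _), norm_pow]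
      exact mul_le_of_le_one_right (hT.nonneg _) (pow_le_one₀ (norm_nonneg _) hz)
  have h1 : HasSum (fun x => (T x : ℂ) * z ^ x) (z * (∑' x, (T (x + 1) : ℂ) * z ^ x) + 1) := by
    refine (hasSum_nat_add_iff' 1).1 ?_
    rw [Finset.sum_range_one, hT.zero, Complex.ofReal_one, pow_zero, mul_one, add_sub_cancel_right]
    exact (hG.hasSum.mul_left z).congr_fun fun x => by ring
  have h2 := (hT.hasSum_tailPGF hz).unique
    ((h1.sub hG.hasSum).congr_fun (fun x => by push_cast; ring))
  rw [h2]; ring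

end IsTail

/-- The filter of real numbers approaching `1` from below, seen in the complex plane. -/
theorem map_ofReal_nhdsLT_one_le :
    map ((↑) : ℝ → ℂ) (𝓝[<] 1) ≤ 𝓝[Metric.closedBall 0 1 \ {1}] (1 : ℂ) := by
  refine tendsto_nhdsWithin_iff.2 ⟨?_, ?_⟩
  · exact (Complex.continuous_ofReal.tendsto' 1 1 (by simp)).mono_left nhdsWithin_le_nhds
  · filter_upwards [Ioo_mem_nhdsLT (zero_lt_one' ℝ)] with x hx
    refine ⟨?_, ?_⟩
    · simpa [abs_of_pos hx.1] using hx.2.le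
    · simpa using hx.2.ne

instance neBot_closedBall_diff_one : (𝓝[Metric.closedBall 0 1 \ {1}] (1 : ℂ)).NeBot :=
  neBot_of_le map_ofReal_nhdsLT_one_le

/-! ### Monotonicity of the cycle operator, geometric bound and limiting tail -/

section Steps

variable {p q : ℝ}

theorem redStep_mono (hp : 0 ≤ p) (hq : 0 ≤ q) : Monotone (redStep p q)
  | _, _, _, 0 => le_rfl
  | _, _, h, x + 1 => add_le_add (mul_le_mul_of_nonneg_left (h (x + 1)) hq)
      (mul_le_mul_of_nonneg_left (h x) hp)

theorem greenStep_mono (hp : 0 ≤ p) (hq : 0 ≤ q) : Monotone (greenStep p q)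
  | _, _, _, 0 => le_rfl
  | _, _, h, x + 1 => add_le_add (mul_le_mul_of_nonneg_left (h (x + 1)) hp)
      (mul_le_mul_of_nonneg_left (h (x + 2)) hq)

theorem cycleStep_mono (hp : 0 ≤ p) (hq : 0 ≤ q) : Monotone (cycleStep p q) :=
  (greenStep_mono hp hq).comp <| (greenStep_mono hp hq).comp <|
    (redStep_mono hp hq).comp (redStep_mono hp hq)

theorem continuous_redStep : Continuous (redStep p q) :=
  continuous_pi fun x => by cases x <;> simp only [redStep] <;> fun_prop

theorem continuous_greenStep : Continuous (greenStep p q) :=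
  continuous_pi fun x => by cases x <;> simp only [greenStep] <;> fun_prop

theorem continuous_cycleStep : Continuous (cycleStep p q) :=
  continuous_greenStep.comp <| continuous_greenStep.comp <|
    continuous_redStep.comp continuous_redStep

/-- With `ρ = p² / q²`, one has `q + p / ρ = q / p`, so equality holds at positive arguments. The
hypothesis on `c` is needed only at `0`, where the step resets the value to `1`. -/
theorem redStep_geometric_le (hp : 0 < p) (hq : 0 < q) (hpq : p + q = 1) {c : ℝ}
    (hc : 1 ≤ c * (q / p)) :
    redStep p q (fun x => c * (p ^ 2 / q ^ 2) ^ x) ≤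
      fun x => c * (q / p) * (p ^ 2 / q ^ 2) ^ x
  | 0 => by simpa [redStep] using hc
  | x + 1 => by
    refine le_of_eq ?_
    simp only [redStep, pow_succ]
    field_simp
    linear_combination c * hpq

theorem greenStep_geometric_le (hq : 0 < q) (hpq : p + q = 1) {c : ℝ}
    (hc : 1 ≤ c * (p / q)) :
    greenStep p q (fun x => c * (p ^ 2 / q ^ 2) ^ x) ≤
      fun x => c * (p / q) * (p ^ 2 / q ^ 2) ^ x
  | 0 => by simpa [greenStep] using hc
  | x + 1 => by
    refine le_of_eq ?_
    have key : p + q * (p ^ 2 / q ^ 2) = p / q := by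
      field_simp
      linear_combination p * hpq
    simp only [greenStep]
    linear_combination c * (p ^ 2 / q ^ 2) ^ (x + 1) * key

/-- Two factors `q / p` from red and two factors `p / q` from green cancel. The running constants `q
/ p`, `(q / p)²`, `q / p`, `1` never drop below `1`, as the value at `0` requires. -/
theorem cycleStep_geometric_le (hp : 0 < p) (hpq : p + q = 1) (hle : p ≤ q) :
    cycleStep p q (fun x => (p ^ 2 / q ^ 2) ^ x) ≤ fun x => (p ^ 2 / q ^ 2) ^ x := by
  have hq := hp.trans_le hle
  have h : 1 ≤ q / p := (one_le_div hp).2 hle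
  have hinv : q / p * (p / q) = 1 := by field_simp
  have h1 := redStep_geometric_le (c := 1) hp hq hpq (by simpa using h)
  have h2 := redStep_geometric_le (c := 1 * (q / p)) hp hq hpq (by nlinarith)
  have h3 := greenStep_geometric_le (p := p) (c := 1 * (q / p) * (q / p)) hq hpq
    (by rw [mul_assoc, hinv]; simpa using h)
  have h4 := greenStep_geometric_le (p := p) (c := 1 * (q / p) * (q / p) * (p / q)) hq hpq
    (by rw [mul_assoc (1 * (q / p)), hinv, mul_one, one_mul, hinv])
  have hred := redStep_mono hp.le hq.le
  have hgreen := greenStep_mono hp.le hq.le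
  have := (hgreen (hgreen ((hred h1).trans h2))).trans ((hgreen h3).trans h4)
  simpa only [cycleStep, mul_assoc, hinv, mul_one, one_mul] using this

theorem isTail_iterate (hp : 0 ≤ p) (hq : 0 ≤ q) (hpq : p + q = 1) (n : ℕ) :
    IsTail ((cycleStep p q)^[n] zeroTail) := by
  induction n with
  | zero => exact isTail_zeroTail
  | succ n ih => rw [Function.iterate_succ_apply']; exact ih.cycleStep hp hq hpq

theorem iterate_le_geometric (hp : 0 < p) (hpq : p + q = 1) (hle : p ≤ q) (n : ℕ) :
    (cycleStep p q)^[n] zeroTail ≤ fun x => (p ^ 2 / q ^ 2) ^ x := by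
  induction n with
  | zero => exact zeroTail_le (by simp) fun x => by positivity
  | succ n ih =>
    rw [Function.iterate_succ_apply']
    exact (cycleStep_mono hp.le (hp.le.trans hle) ih).trans (cycleStep_geometric_le hp hpq hle)

theorem exists_limit_tail (hp : 0 ≤ p) (hq : 0 ≤ q) (hpq : p + q = 1) :
    ∃ L : ℕ → ℝ, IsTail L ∧ cycleStep p q L = L ∧
      ∀ x, Tendsto (fun n => (cycleStep p q)^[n] zeroTail x) atTop (𝓝 (L x)) := by
  have hT := isTail_iterate hp hq hpq
  have hmono : Monotone fun n => (cycleStep p q)^[n] zeroTail :=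
    (cycleStep_mono hp hq).monotone_iterate_of_le_map
      (zeroTail_le le_rfl (isTail_zeroTail.cycleStep hp hq hpq).nonneg)
  have hlim : ∀ x, Tendsto (fun n => (cycleStep p q)^[n] zeroTail x) atTop
      (𝓝 (⨆ n, (cycleStep p q)^[n] zeroTail x)) := fun x =>
    tendsto_atTop_ciSup (fun m n h => hmono h x) ⟨1, by rintro _ ⟨n, rfl⟩; exact (hT n).le_one x⟩
  set L : ℕ → ℝ := fun x => ⨆ n, (cycleStep p q)^[n] zeroTail x
  refine ⟨L, ⟨?_, ?_, ?_⟩, ?_, hlim⟩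
  · exact tendsto_nhds_unique (hlim 0) (by simp [(hT _).zero])
  · exact fun x y hxy => le_of_tendsto_of_tendsto' (hlim y) (hlim x) fun n => (hT n).anti hxy
  · exact fun x => ge_of_tendsto' (hlim x) fun n => (hT n).nonneg x
  -- Pointwise convergence is convergence in the product topology, where `cycleStep` is continuous,
  -- so the limit is fixed.
  · have h := tendsto_pi_nhds.2 hlim
    have h1 := (continuous_cycleStep (p := p) (q := q)).tendsto L |>.comp h
    have h2 := h.comp (tendsto_add_atTop_nat 1)
    refine tendsto_nhds_unique h1 (h2.congr fun n => ?_)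
    simp [Function.iterate_succ_apply']

end Steps

/-! ### Identification of the fixed tail -/

section Fixed

variable {p q : ℝ} (hp : 0 < p) (hpq : p + q = 1) (hle : p ≤ q) {L : ℕ → ℝ} (hL : IsTail L)
  (hfix : cycleStep p q L = L)
include hp hpq hle hL hfix

theorem tailPGF_mul_eq {z : ℂ} (hz : ‖z‖ ≤ 1) :
    (q ^ 2 - p ^ 2 * z) * (q ^ 2 + (1 + 2 * p * q) * z + p ^ 2 * z ^ 2) * tailPGF L z = q *
      ((q + p * z) * (1 - redStep p q (redStep p q L) 1 : ℝ) + z *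
        (1 - greenStep p q (redStep p q (redStep p q L)) 1 : ℝ)) := by
  have hne : ∀ z : ℂ, ‖z‖ ≤ 1 → z ≠ 1 →
      (q ^ 2 - p ^ 2 * z) * (q ^ 2 + (1 + 2 * p * q) * z + p ^ 2 * z ^ 2) * tailPGF L z = q *
      ((q + p * z) * (1 - redStep p q (redStep p q L) 1 : ℝ) + z *
        (1 - greenStep p q (redStep p q (redStep p q L)) 1 : ℝ)) := by
    intro z hz h1
    apply mul_left_cancel₀ (sub_ne_zero.2 h1)
    rw [← hL.tailPGF_fixed hp.le (hp.le.trans hle) hpq hfix hz]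
    linear_combination tailPGF L z * pow_four_sub_sq_factorization hpq z
  rcases ne_or_eq z 1 with h1 | rfl
  · exact hne z hz h1
  -- Division by `z - 1` fails at `z = 1`, so both sides are extended there by continuity within the
  -- closed disc.
  have hc : Tendsto (tailPGF L) (𝓝[Metric.closedBall 0 1 \ {1}] 1) (𝓝 (tailPGF L 1)) :=
    (hL.continuousOn_tailPGF 1 (by simp)).mono_left (nhdsWithin_mono _ Set.sdiff_subset)
  have hl : Tendsto (fun z : ℂ => ((q ^ 2 - p ^ 2 * z) *
      (q ^ 2 + (1 + 2 * p * q) * z + p ^ 2 * z ^ 2) : ℂ)) (𝓝[Metric.closedBall 0 1 \ {1}] 1)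
      (𝓝 ((q ^ 2 - p ^ 2 * 1) * (q ^ 2 + (1 + 2 * p * q) * 1 + p ^ 2 * 1 ^ 2))) :=
    Continuous.continuousWithinAt (f := fun z : ℂ => ((q ^ 2 - p ^ 2 * z) *
      (q ^ 2 + (1 + 2 * p * q) * z + p ^ 2 * z ^ 2) : ℂ)) (by fun_prop)
  refine tendsto_nhds_unique_of_eventuallyEq (hl.mul hc)
    (Continuous.continuousWithinAt (f := fun z : ℂ => (q *
      ((q + p * z) * (1 - redStep p q (redStep p q L) 1 : ℝ) + z *
        (1 - greenStep p q (redStep p q (redStep p q L)) 1 : ℝ)) : ℂ)) (by fun_prop)) ?_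
  filter_upwards [self_mem_nhdsWithin] with z hz
  exact hne z (by simpa using hz.1) hz.2

theorem boundary_weights (hlim : p < q → Tendsto L atTop (𝓝 0)) :
    1 - redStep p q (redStep p q L) 1 = weightZero p q ∧
      1 - greenStep p q (redStep p q (redStep p q L)) 1 = weightOne p q := by
  have hq : (q : ℂ) ≠ 0 := by exact_mod_cast (hp.trans_le hle).ne'
  have hq' : (q : ℂ) = 1 - p := by rw [← Complex.ofReal_one, ← hpq]; push_cast; ring
  have h1 := tailPGF_mul_eq hp hpq hle hL hfix (z := 1) (by simp)
  have hz : ((innerRoot p q : ℂ)) ∈ {z : ℂ | z ^ 2 = (q + p * z) ^ 4 ∧ ‖z‖ ≤ 1} := by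
    rw [setOf_roots_closedBall hp hpq hle]; simp
  have h2 := tailPGF_mul_eq hp hpq hle hL hfix hz.2
  rw [quadratic_factor hp hle, sub_self, mul_zero, zero_mul, mul_zero, zero_mul] at h2
  -- For `p = q` both sides vanish, so the critical case does not need total mass one.
  have hm : (q - p) * tailPGF L 1 = (q - p : ℂ) := by
    rcases hle.lt_or_eq with h | h
    · rw [hL.tailPGF_one (hlim h), mul_one]
    · simp [h]
  have := weights_unique hp hpq hle (a := (1 - redStep p q (redStep p q L) 1 : ℝ))
    (b := (1 - greenStep p q (redStep p q (redStep p q L)) 1 : ℝ)) ?_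
    ((mul_eq_zero.1 h2.symm).resolve_left hq)
  · exact_mod_cast this
  · rw [eq_div_iff hq, ← hm]
    have e : ((q ^ 2 - p ^ 2 * 1) * (q ^ 2 + (1 + 2 * p * q) * 1 + p ^ 2 * 1 ^ 2) : ℂ)
      = 2 * (q - p) := by rw [hq']; ring
    have e' : (q + p * 1 : ℂ) = 1 := by rw [hq']; ring
    rw [e, e'] at h1
    linear_combination -h1

theorem one_sub_limit_tail_one (hlim : p < q → Tendsto L atTop (𝓝 0)) :
    L 0 - L 1 = weightZero p q / q ^ 2 := by
  have hq := hp.trans_le hle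
  obtain ⟨h, -⟩ := boundary_weights hp hpq hle hL hfix hlim
  simp only [redStep, hL.zero] at h
  rw [eq_div_iff (by positivity), ← h, hL.zero]
  have : p = 1 - q := by linarith
  subst this
  simp
  ring

/-- With `πₓ = L x - L (x + 1)`, the queue is empty before the first green step with probability `w₀
= q² π₀`, and before the second with `w₁ = (1 + 2 p) w₀ + q³ π₁`. -/
theorem limit_tail_one_sub_two (hlim : p < q → Tendsto L atTop (𝓝 0)) :
    L 1 - L 2 = (weightOne p q - (1 + 2 * p) * weightZero p q) / q ^ 3 := by
  have hq := hp.trans_le hle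
  obtain ⟨h, h'⟩ := boundary_weights hp hpq hle hL hfix hlim
  simp only [redStep, greenStep, hL.zero] at h h'
  rw [eq_div_iff (by positivity), ← h, ← h']
  have : p = 1 - q := by linarith
  subst this
  simp
  ring

theorem tailPGF_eq_explicitPGF (hlt : p < q) (hlim : Tendsto L atTop (𝓝 0)) {z : ℂ}
    (hz : ‖z‖ ≤ 1) (hne : z ≠ innerRoot p q) : tailPGF L z = explicitPGF p q z := by
  have hq := hp.trans hlt
  obtain ⟨h0, h1⟩ := boundary_weights hp hpq hle hL hfix fun _ => hlim
  have h := tailPGF_mul_eq hp hpq hle hL hfix hz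
  rw [h0, h1] at h
  have hqz : (q + p * z : ℂ) ≠ 0 := by
    intro e
    have : (q : ℂ) = -(p * z) := by linear_combination e
    have := congrArg norm this
    rw [norm_neg, norm_mul, Complex.norm_real, Complex.norm_real, Real.norm_of_nonneg hq.le,
      Real.norm_of_nonneg hp.le] at this
    nlinarith [mul_le_of_le_one_right hp.le hz]
  rw [explicitPGF_eq hp hpq hle hqz]
  rcases ne_or_eq z 1 with hz1 | rfl
  · rw [eq_div_iff, ← h, mul_comm]
    intro e
    have hmem : z ∈ {z : ℂ | z ^ 2 = (q + p * z) ^ 4 ∧ ‖z‖ ≤ 1} := by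
      refine ⟨?_, hz⟩
      linear_combination -pow_four_sub_sq_factorization hpq z - (1 - z) * e
    rw [setOf_roots_closedBall hp hpq hle] at hmem
    rcases hmem with hmem | hmem
    · exact hz1 hmem
    · exact hne hmem
  · rw [eq_div_iff, ← h, mul_comm]
    have hq' : (q : ℂ) = 1 - p := by rw [← Complex.ofReal_one, ← hpq]; push_cast; ring
    have e : ((q ^ 2 - p ^ 2 * 1) * (q ^ 2 + (1 + 2 * p * q) * 1 + p ^ 2 * 1 ^ 2) : ℂ)
      = 2 * (q - p) := by rw [hq']; ring
    rw [e]
    exact mul_ne_zero two_ne_zero (by exact_mod_cast (sub_pos.2 hlt).ne')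

theorem tsum_limit_tail (hlt : p < q) (hs : Summable fun x => L (x + 1)) :
    ∑' x, L (x + 1) = (-4 + 2 * (q - p) + 1 / (q - p) + √(1 + 4 * p * q)) / 4 := by
  have hlim : Tendsto L atTop (𝓝 0) := (tendsto_add_atTop_iff_nat 1).1 hs.tendsto_atTop_zero
  have hz1 : (1 : ℂ) ≠ innerRoot p q := by
    have := innerRoot_neg hp hle
    exact_mod_cast (this.trans one_pos).ne'
  have hH1 : explicitPGF p q 1 = 1 := by
    rw [← tailPGF_eq_explicitPGF hp hpq hle hL hfix hlt hlim (by simp) hz1, hL.tailPGF_one hlim]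
  have hsub : Metric.closedBall 0 1 \ {1} ⊆ ({1} : Set ℂ)ᶜ := fun z hz => hz.2
  have hslope := (hasDerivAt_iff_tendsto_slope.1
    (hasDerivAt_explicitPGF_one hp hpq hle hlt)).mono_left
      (nhdsWithin_mono (1 : ℂ) hsub)
  have hG : ContinuousOn (fun z : ℂ => ∑' x, (L (x + 1) : ℂ) * z ^ x) (Metric.closedBall 0 1) :=
    continuousOn_tsum (fun _ => by fun_prop) hs fun x z hz => by
      rw [norm_mul, Complex.norm_real, Real.norm_of_nonneg (hL.nonneg _), norm_pow]
      exact mul_le_of_le_one_right (hL.nonneg _)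
        (pow_le_one₀ (norm_nonneg _) (by simpa using hz))
  have hG1 := (hG 1 (by simp)).mono_left
    (nhdsWithin_mono (1 : ℂ) (Set.sdiff_subset (t := {1})))
  have := tendsto_nhds_unique_of_eventuallyEq hG1 hslope ?_
  · simp only [one_pow, mul_one] at this
    rw [← Complex.ofReal_tsum] at this
    exact_mod_cast this
  · filter_upwards [self_mem_nhdsWithin,
      mem_nhdsWithin_of_mem_nhds (isOpen_ne.mem_nhds hz1)] with z hz hne
    have hzn : ‖z‖ ≤ 1 := by simpa using hz.1
    have hz0 : z - 1 ≠ 0 := sub_ne_zero.2 hz.2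
    rw [slope_def_field, hH1, ← tailPGF_eq_explicitPGF hp hpq hle hL hfix hlt hlim hzn hne,
      hL.one_sub_mul_tsum hs hzn, mul_div_cancel_left₀ _ hz0]

end Fixed

/-! ### From the random walk to the tail recursion -/

theorem queueLength_nonneg {Ω : Type*} {X : ℕ → Ω → ℤ} (h0 : ∀ ω, X 0 ω = 0) (n : ℕ) (ω : Ω) :
    0 ≤ queueLength X n ω := by
  cases n with
  | zero => simp [queueLength, h0]
  | succ n => exact le_max_right _ _

section Probability

variable {Ω : Type*} [MeasurableSpace Ω] {μ : Measure Ω}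

theorem measurable_queueLength_natural {X : ℕ → Ω → ℤ} (hX : ∀ i, StronglyMeasurable (X i))
    (n : ℕ) : Measurable[Filtration.natural X hX n] (queueLength X n) := by
  have hadapt : ∀ i, Measurable[Filtration.natural X hX i] (X i) := fun i =>
    ((Filtration.stronglyAdapted_natural hX) i).measurable
  induction n with
  | zero => exact hadapt 0
  | succ n ih =>
    exact ((ih.mono ((Filtration.natural X hX).mono n.le_succ) le_rfl).add
      (hadapt (n + 1))).max measurable_const

theorem measurable_queueLength {X : ℕ → Ω → ℤ} (hX : ∀ i, Measurable (X i)) (n : ℕ) :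
    Measurable (queueLength X n) := by
  induction n with
  | zero => exact hX 0
  | succ n ih => exact (ih.add (hX (n + 1))).max measurable_const

/-- The queue at time `n` depends only on the steps up to `n`. -/
theorem indepFun_queueLength {X : ℕ → Ω → ℤ} (hX : ∀ i, Measurable (X i)) (hi : iIndepFun X μ)
    (n : ℕ) : IndepFun (X (n + 1)) (queueLength X n) μ :=
  indep_of_indep_of_le_right
    (hi.indep_comap_natural_of_lt (fun i => (hX i).stronglyMeasurable) n.lt_succ_self)
    (measurable_queueLength_natural (fun i => (hX i).stronglyMeasurable) n).comap_le

/-- The tail function of the queue length at time `n`. -/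
noncomputable def queueTail (μ : Measure Ω) (X : ℕ → Ω → ℤ) (n x : ℕ) : ℝ :=
  μ.real {ω | (x : ℤ) ≤ queueLength X n ω}

variable [IsProbabilityMeasure μ]

theorem ae_eq_or_eq {Y : Ω → ℤ} (hY : Measurable Y) {a b : ℤ} (hab : a ≠ b) {s t : ℝ}
    (ha : μ.real {ω | Y ω = a} = s) (hb : μ.real {ω | Y ω = b} = t) (hst : s + t = 1) :
    ∀ᵐ ω ∂μ, Y ω = a ∨ Y ω = b := by
  have hma : MeasurableSet {ω | Y ω = a} := hY (measurableSet_singleton a)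
  have hmb : MeasurableSet {ω | Y ω = b} := hY (measurableSet_singleton b)
  have hd : Disjoint {ω | Y ω = a} {ω | Y ω = b} :=
    Set.disjoint_left.2 fun ω h h' => hab (h.symm.trans h')
  have h1 : μ.real ({ω | Y ω = a} ∪ {ω | Y ω = b}) = 1 := by
    rw [measureReal_union hd hmb, ha, hb, hst]
  rw [measureReal_def, ENNReal.toReal_eq_one_iff] at h1
  exact (prob_compl_eq_zero_iff (hma.union hmb)).2 h1

theorem measureReal_le_add {Y S : Ω → ℤ} (hY : Measurable Y) (hS : Measurable S)
    (hi : IndepFun Y S μ) {a b : ℤ} (hab : a ≠ b) {s t : ℝ}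
    (ha : μ.real {ω | Y ω = a} = s) (hb : μ.real {ω | Y ω = b} = t) (hst : s + t = 1) (c : ℤ) :
    μ.real {ω | c ≤ S ω + Y ω} =
      s * μ.real {ω | c - a ≤ S ω} + t * μ.real {ω | c - b ≤ S ω} := by
  have hae : {ω | c ≤ S ω + Y ω} =ᵐ[μ]
      ({ω | Y ω = a} ∩ {ω | c - a ≤ S ω} ∪ {ω | Y ω = b} ∩ {ω | c - b ≤ S ω} : Set Ω) := by
    filter_upwards [ae_eq_or_eq hY hab ha hb hst] with ω hω
    apply propext
    change c ≤ S ω + Y ω ↔ (Y ω = a ∧ c - a ≤ S ω) ∨ (Y ω = b ∧ c - b ≤ S ω)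
    omega
  have hmS : ∀ d : ℤ, MeasurableSet {ω | d ≤ S ω} := fun d => hS measurableSet_Ici
  have hmb : MeasurableSet {ω | Y ω = b} := hY (measurableSet_singleton b)
  have hd : Disjoint ({ω | Y ω = a} ∩ {ω | c - a ≤ S ω}) ({ω | Y ω = b} ∩ {ω | c - b ≤ S ω}) :=
    Set.disjoint_left.2 fun ω h h' => hab (h.1.symm.trans h'.1)
  have hprod : ∀ y d : ℤ, μ.real ({ω | Y ω = y} ∩ {ω | d ≤ S ω}) =
      μ.real {ω | Y ω = y} * μ.real {ω | d ≤ S ω} := fun y d => by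
    simp only [measureReal_def, ← ENNReal.toReal_mul]
    congr 1
    exact hi.measure_inter_preimage_eq_mul {y} (Set.Ici d) (measurableSet_singleton y)
      measurableSet_Ici
  rw [measureReal_congr hae, measureReal_union hd (hmb.inter (hmS _)), hprod, hprod, ha, hb]

theorem measureReal_queueLength_eq {X : ℕ → Ω → ℤ} (hX : ∀ i, Measurable (X i)) (n x : ℕ) :
    μ.real {ω | queueLength X n ω = x} = queueTail μ X n x - queueTail μ X n (x + 1) := by
  have hm : ∀ d : ℤ, MeasurableSet {ω | d ≤ queueLength X n ω} := fun d =>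
    measurable_queueLength hX n measurableSet_Ici
  rw [queueTail, queueTail, ← measureReal_sdiff _ (hm _)]
  · congr 1
    ext ω
    simp only [Set.mem_ofPred_eq, Set.mem_sdiff]
    omega
  · intro ω
    simp only [Set.mem_ofPred_eq]
    omega

variable {p q : ℝ} {X : ℕ → Ω → ℤ}

theorem queueTail_zero (h0 : ∀ ω, X 0 ω = 0) : queueTail μ X 0 = zeroTail := by
  ext x
  cases x with
  | zero => simp [queueTail, zeroTail, queueLength, h0]
  | succ x =>
    have h : ¬ ((x + 1 : ℕ) : ℤ) ≤ 0 := by omega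
    simp only [queueTail, zeroTail, queueLength, h0, h]
    exact measureReal_empty

theorem queueTail_succ_red (hX : ∀ i, Measurable (X i)) (hi : iIndepFun X μ)
    (hpq : p + q = 1) {n : ℕ}
    (h : μ.real {ω | X (n + 1) ω = 1} = p ∧ μ.real {ω | X (n + 1) ω = 0} = q) :
    queueTail μ X (n + 1) = redStep p q (queueTail μ X n) := by
  ext x
  cases x with
  | zero => simp [queueTail, redStep, queueLength]
  | succ x =>
    have h1 := measureReal_le_add (hX (n + 1)) (measurable_queueLength hX n)
      (indepFun_queueLength hX hi n) one_ne_zero h.1 h.2 hpq ((x + 1 : ℕ) : ℤ)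
    -- Reflection at `0` is invisible at positive levels.
    have h2 : {ω | ((x + 1 : ℕ) : ℤ) ≤ queueLength X (n + 1) ω} =
        {ω | ((x + 1 : ℕ) : ℤ) ≤ queueLength X n ω + X (n + 1) ω} := by
      ext ω
      simp only [Set.mem_ofPred_eq, queueLength]
      omega
    rw [redStep, queueTail, h2, h1]
    simp [queueTail, add_comm]

theorem queueTail_succ_green (hX : ∀ i, Measurable (X i)) (hi : iIndepFun X μ)
    (hpq : p + q = 1) {n : ℕ}
    (h : μ.real {ω | X (n + 1) ω = 0} = p ∧ μ.real {ω | X (n + 1) ω = -1} = q) :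
    queueTail μ X (n + 1) = greenStep p q (queueTail μ X n) := by
  ext x
  cases x with
  | zero => simp [queueTail, greenStep, queueLength]
  | succ x =>
    have h1 := measureReal_le_add (hX (n + 1)) (measurable_queueLength hX n)
      (indepFun_queueLength hX hi n) (by norm_num) h.1 h.2 hpq ((x + 1 : ℕ) : ℤ)
    have h2 : {ω | ((x + 1 : ℕ) : ℤ) ≤ queueLength X (n + 1) ω} =
        {ω | ((x + 1 : ℕ) : ℤ) ≤ queueLength X n ω + X (n + 1) ω} := by
      ext ω
      simp only [Set.mem_ofPred_eq, queueLength]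
      omega
    rw [greenStep, queueTail, h2, h1]
    simp [queueTail, add_assoc]

namespace IsTrafficSteps

variable (hX : IsTrafficSteps μ 2 p q X) (hpq : p + q = 1)
include hX hpq

theorem queueTail_four_mul (n : ℕ) :
    queueTail μ X (4 * n) = (cycleStep p q)^[n] zeroTail := by
  induction n with
  | zero => exact queueTail_zero hX.zero
  | succ n ih =>
    rw [Function.iterate_succ_apply', ← ih, cycleStep]
    have r1 := hX.red (4 * n + 1) (by omega) ⟨1, by omega, by omega, by simp [Nat.ModEq]⟩
    have r2 := hX.red (4 * n + 2) (by omega) ⟨2, by omega, by omega, by simp [Nat.ModEq]⟩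
    have g3 := hX.green (4 * n + 3) (by omega) ⟨3, by omega, by omega, by simp [Nat.ModEq]⟩
    have g4 := hX.green (4 * n + 4) (by omega) ⟨4, by omega, by omega, by simp [Nat.ModEq]⟩
    rw [show 4 * (n + 1) = 4 * n + 3 + 1 by ring,
      queueTail_succ_green hX.measurable hX.indep hpq g4,
      queueTail_succ_green hX.measurable hX.indep hpq g3,
      queueTail_succ_red hX.measurable hX.indep hpq r2,
      queueTail_succ_red hX.measurable hX.indep hpq r1]

theorem ae_step_le_one (n : ℕ) : ∀ᵐ ω ∂μ, X n ω ≤ 1 := by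
  rcases n.eq_zero_or_pos with rfl | hn
  · exact .of_forall fun ω => by simp [hX.zero]
  have hcase : n % 4 = 1 ∨ n % 4 = 2 ∨ n % 4 = 3 ∨ n % 4 = 0 := by omega
  have hred : ∀ r, 1 ≤ r → r ≤ 2 → n % 4 = r % 4 → ∀ᵐ ω ∂μ, X n ω ≤ 1 := fun r h1 h2 h => by
    have := hX.red n hn ⟨r, h1, h2, h⟩
    filter_upwards [ae_eq_or_eq (hX.measurable n) one_ne_zero this.1 this.2 hpq] with ω hω
    omega
  have hgreen : ∀ r, 3 ≤ r → r ≤ 4 → n % 4 = r % 4 → ∀ᵐ ω ∂μ, X n ω ≤ 1 := fun r h1 h2 h => by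
    have := hX.green n hn ⟨r, h1, h2, h⟩
    filter_upwards [ae_eq_or_eq (hX.measurable n) (by norm_num) this.1 this.2 hpq] with ω hω
    omega
  rcases hcase with h | h | h | h
  · exact hred 1 (by norm_num) (by norm_num) h
  · exact hred 2 (by norm_num) (by norm_num) h
  · exact hgreen 3 (by norm_num) (by norm_num) h
  -- Residue `0` is represented by `4` in the range of green residues.
  · exact hgreen 4 (by norm_num) (by norm_num) h

theorem ae_queueLength_le (n : ℕ) : ∀ᵐ ω ∂μ, queueLength X n ω ≤ n := by
  induction n with
  | zero => exact .of_forall fun ω => by simp [queueLength, hX.zero]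
  | succ n ih =>
    filter_upwards [ih, hX.ae_step_le_one hpq (n + 1)] with ω h1 h2
    simp only [queueLength]
    omega

theorem integrable_queueLength (n : ℕ) :
    Integrable (fun ω => (queueLength X n ω : ℝ)) μ := by
  refine Integrable.of_bound (C := n)
    ((measurable_from_top (f := fun k : ℤ => (k : ℝ))).comp
      (measurable_queueLength hX.measurable n)).aestronglyMeasurable ?_
  filter_upwards [hX.ae_queueLength_le hpq n] with ω h
  rw [Real.norm_of_nonneg (by exact_mod_cast queueLength_nonneg hX.zero n ω)]
  exact_mod_cast h

/-- Layer-cake formula; almost surely the queue is at most `n` at time `n`, so only finitely many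
levels contribute. -/
theorem integral_queueLength (n : ℕ) :
    ∫ ω, (queueLength X n ω : ℝ) ∂μ = ∑' x, queueTail μ X n (x + 1) := by
  have hm : ∀ d : ℤ, MeasurableSet {ω | d ≤ queueLength X n ω} := fun d =>
    measurable_queueLength hX.measurable n measurableSet_Ici
  rw [tsum_eq_sum (s := Finset.range n)]
  · have hae : (fun ω => (queueLength X n ω : ℝ)) =ᵐ[μ] fun ω => ∑ x ∈ Finset.range n,
        {ω | ((x + 1 : ℕ) : ℤ) ≤ queueLength X n ω}.indicator (1 : Ω → ℝ) ω := by
      filter_upwards [hX.ae_queueLength_le hpq n] with ω h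
      have h0 := queueLength_nonneg hX.zero n ω
      simp only [Set.indicator_apply, Set.mem_ofPred_eq, Pi.one_apply]
      generalize queueLength X n ω = k at h h0
      lift k to ℕ using h0
      have : (Finset.range n).filter (fun x => ((x + 1 : ℕ) : ℤ) ≤ k) = Finset.range k := by
        ext x
        simp only [Finset.mem_filter, Finset.mem_range]
        omega
      rw [Finset.sum_boole, this]
      simp
    rw [integral_congr_ae hae, integral_finsetSum]
    · exact Finset.sum_congr rfl fun x _ => integral_indicator_one (hm _)
    · exact fun x _ => (integrable_const (1 : ℝ)).indicator (hm _)
  · intro x hx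
    rw [queueTail, measureReal_eq_zero_iff, measure_eq_zero_iff_ae_notMem]
    filter_upwards [hX.ae_queueLength_le hpq n] with ω h
    rw [Finset.mem_range] at hx
    omega

end IsTrafficSteps

end Probability

/-! ### Assembly of the main theorem -/

theorem mainTheorem4 {Ω : Type*} [MeasurableSpace Ω] (μ : Measure Ω) [IsProbabilityMeasure μ]
    (p q : ℝ) (hp : 0 < p) (hpq : p + q = 1) (hle : p ≤ q)
    (X : ℕ → Ω → ℤ) (hX : IsTrafficSteps μ 2 p q X) :
    -- the factorization
    (∀ z : ℂ, (q + p * z) ^ 4 - z ^ 2 =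
      (1 - z) * (q ^ 2 - p ^ 2 * z) * (q ^ 2 + (1 + 2 * p * q) * z + p ^ 2 * z ^ 2)) ∧
    -- the roots in the closed unit disc
    {z : ℂ | z ^ 2 = (q + p * z) ^ 4 ∧ ‖z‖ ≤ 1} = {1, (innerRoot p q : ℂ)} ∧
    (innerRoot p q : ℂ) ≠ 1 ∧ (q + p * innerRoot p q : ℂ) ≠ 0 ∧
    -- the weights are the unique solution of the linear system
    (∀ w : Fin 2 → ℂ,
      (weightMatrix p q ![1, (innerRoot p q : ℂ)]).mulVec w = weightRHS 2 p q ↔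
        w = ![(weightZero p q : ℂ), (weightOne p q : ℂ)]) ∧
    -- the generating function built from the weights has the explicit form
    (∀ z : ℂ, z ^ 2 ≠ (q + p * z) ^ 4 → q + p * z ≠ 0 →
      weightPGF p q ![(weightZero p q : ℂ), (weightOne p q : ℂ)] z = explicitPGF p q z) ∧
    -- the limiting probabilities of the values 0 and 1
    Tendsto (fun n : ℕ => μ.real {ω | queueLength X (4 * n) ω = 0}) atTop
      (𝓝 (4 * (q - p) / (q ^ 2 * (1 + 2 * q + √(1 + 4 * p * q))))) ∧
    Tendsto (fun n : ℕ => μ.real {ω | queueLength X (4 * n) ω = 1}) atTop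
      (𝓝 (4 * (q - p) * (1 + 2 * p * q * (q - p) - (q - p + 2 * p * q) * √(1 + 4 * p * q)) /
        (q ^ 4 * (-(q - p) + √(1 + 4 * p * q)) * (1 + 2 * q + √(1 + 4 * p * q))))) ∧
    (p < q →
      -- there is a limiting distribution, and its generating function is the explicit one
      (∃ law : ℕ → ℝ,
        (∀ x : ℕ, Tendsto (fun n : ℕ => μ.real {ω | queueLength X (4 * n) ω = x}) atTop
          (𝓝 (law x))) ∧
        HasSum law 1 ∧
        ∀ z : ℂ, ‖z‖ ≤ 1 → z ≠ innerRoot p q →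
          HasSum (fun x : ℕ => (law x : ℂ) * z ^ x) (explicitPGF p q z)) ∧
      -- the limiting mean
      (∀ n : ℕ, Integrable (fun ω => (queueLength X n ω : ℝ)) μ) ∧
      Tendsto (fun n : ℕ => ∫ ω, (queueLength X (4 * n) ω : ℝ) ∂μ) atTop
        (𝓝 ((-4 + 2 * (q - p) + 1 / (q - p) + √(1 + 4 * p * q)) / 4)) ∧
      HasDerivAt (explicitPGF p q)
        (((-4 + 2 * (q - p) + 1 / (q - p) + √(1 + 4 * p * q)) / 4 : ℝ) : ℂ) 1) := by
  have hq := hp.trans_le hle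
  obtain ⟨L, hL, hfix, htend⟩ := exists_limit_tail hp.le hq.le hpq
  have hbound : ∀ x, L x ≤ (p ^ 2 / q ^ 2) ^ x := fun x =>
    le_of_tendsto' (htend x) fun n => iterate_le_geometric hp hpq hle n x
  have hratio : p < q → p ^ 2 / q ^ 2 < 1 := fun h =>
    (div_lt_one (by positivity)).2 (pow_lt_pow_left₀ h hp.le two_ne_zero)
  have hlim : p < q → Tendsto L atTop (𝓝 0) := fun h =>
    squeeze_zero hL.nonneg hbound (tendsto_pow_atTop_nhds_zero_of_lt_one (by positivity) (hratio h))
  have hlaw : ∀ x : ℕ, Tendsto (fun n : ℕ => μ.real {ω | queueLength X (4 * n) ω = x}) atTop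
      (𝓝 (L x - L (x + 1))) := fun x => by
    simp only [measureReal_queueLength_eq hX.measurable, hX.queueTail_four_mul hpq]
    exact (htend x).sub (htend (x + 1))
  refine ⟨pow_four_sub_sq_factorization hpq, setOf_roots_closedBall hp hpq hle, ?_, ?_,
    weight_system_iff hp hpq hle, fun z => weightPGF_eq_explicitPGF hp hpq hle, ?_, ?_, fun hlt =>
    ⟨⟨fun x => L x - L (x + 1), hlaw, hL.hasSum_sub (hlim hlt), fun z hz hne => ?_⟩,
    hX.integrable_queueLength hpq, ?_, hasDerivAt_explicitPGF_one hp hpq hle hlt⟩⟩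
  · exact_mod_cast ((innerRoot_neg hp hle).trans one_pos).ne
  · exact_mod_cast (add_mul_innerRoot_pos hp hpq hle).ne'
  · rw [← weightZero_div_eq hp hpq hle, ← one_sub_limit_tail_one hp hpq hle hL hfix hlim]
    exact_mod_cast hlaw 0
  · rw [← second_limit_eq hp hpq hle, ← limit_tail_one_sub_two hp hpq hle hL hfix hlim]
    exact_mod_cast hlaw 1
  · rw [← tailPGF_eq_explicitPGF hp hpq hle hL hfix hlt (hlim hlt) hz hne]
    exact hL.hasSum_tailPGF hz
  · have hgeom : Summable fun x : ℕ => (p ^ 2 / q ^ 2) ^ (x + 1) :=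
      (summable_nat_add_iff 1).2 (summable_geometric_of_lt_one (by positivity) (hratio hlt))
    have hs : Summable fun x => L (x + 1) :=
      hgeom.of_nonneg_of_le (fun x => hL.nonneg _) fun x => hbound _
    rw [← tsum_limit_tail hp hpq hle hL hfix hlt hs]
    simp only [hX.integral_queueLength hpq, hX.queueTail_four_mul hpq]
    -- The geometric tail dominates all iterates uniformly in `n`, so the means converge to the sum
    -- of the limiting tail.
    refine tendsto_tsum_of_dominated_convergence hgeom (fun x => htend (x + 1)) (.of_forall ?_)
    intro n x
    rw [Real.norm_of_nonneg ((isTail_iterate hp.le hq.le hpq n).nonneg _)]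
    exact iterate_le_geometric hp hpq hle n _
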